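/- Let $\mathbb F$ be an algebraically closed field of characteristic $0$, and let $\mathcal L=\mathcal L_{\bar 0}\oplus\mathcal L_{\bar 1}$ be a $\mathbb Z/2$-graded finite-dimensional simple Lie algebra over $\mathbb F$ (so $[\mathcal L_i,\mathcal L_j]\subseteq\mathcal L_{i+j}$) with $\mathcal L_{\bar 1}\neq 0$. Regard $\mathcal L_{\bar 1}$ as an $\mathcal L_{\bar 0}$-module through the bracket of $\mathcal L$. Then: (1) $\mathcal L_{\bar 0}$ is reductive (its radical equals its center) and acts faithfully and completely reducibly on $\mathcal L_{\bar 1}$, which is either an irreducible $\mathcal L_{\bar 0}$-module or the direct sum of two irreducible $\mathcal L_{\bar 0}$-submodules. (2) The center $Z(\mathcal L_{\bar 0})$ is nonzero if and only if $\mathcal L_{\bar 1}$ is not irreducible as an $\mathcal L_{\bar 0}$-module. In this case $\mathcal L_{\bar 1}=\mathcal V\oplus\mathcal W$ for irreducible $\mathcal L_{\bar 0}$-submodules $\mathcal V$ and $\mathcal W$ such that $\mathcal L=\mathcal W\oplus\mathcal L_{\bar 0}\oplus\mathcal V$ is a $\mathbb Z$-grading of the Lie algebra $\mathcal L$ with $\mathcal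 L_{-1}=\mathcal W$, $\mathcal L_0=\mathcal L_{\bar 0}$, $\mathcal L_1=\mathcal V$ and all other components zero. Moreover, $Z(\mathcal L_{\bar 0})=\mathbb F z$ for an element $z$ with $[z,v]=v$ for all $v\in\mathcal V$ and $[z,w]=-w$ for all $w\in\mathcal W$. (3) The vector space of symmetric bilinear forms $b\colon\mathcal L_{\bar 1}\times\mathcal L_{\bar 1}\to\mathbb F$ that are $\mathcal L_{\bar 0}$-invariant, that is, $b([x,u],v)+b(u,[x,v])=0$ for all $x\in\mathcal L_{\bar 0}$ and $u,v\in\mathcal L_{\bar 1}$, has dimension one. -/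

import Mathlib

namespace GradedLie

variable {F L : Type*} [Field F] [LieRing L] [LieAlgebra F L]

/-- The component `𝓛₀` of a `ℤ/2`-grading, as a Lie subalgebra of `𝓛`. -/
def even (𝓛 : ZMod 2 → Submodule F L) [GradedLieAlgebra 𝓛] : LieSubalgebra F L where
  toSubmodule := 𝓛 0
  lie_mem' := by
    intro x y hx hy
    have h : ⁅x, y⁆ ∈ 𝓛 (0 + 0) := SetLike.GradedBracket.bracket_mem hx hy
    rwa [add_zero] at h

/-- The component `𝓛₁` of a `ℤ/2`-grading, as a module for `𝓛₀` under the bracket of `𝓛`. -/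
def odd (𝓛 : ZMod 2 → Submodule F L) [GradedLieAlgebra 𝓛] : LieSubmodule F (even 𝓛) L where
  __ := 𝓛 1
  lie_mem := by
    intro x m hm
    have hx : (x : L) ∈ 𝓛 0 := x.2
    have h : ⁅(x : L), m⁆ ∈ 𝓛 (0 + 1) := SetLike.GradedBracket.bracket_mem hx hm
    rwa [zero_add] at h

end GradedLie

/-- The space of symmetric bilinear forms `B` on a `g`-module `M` which are `g`-invariant, that is,
`B (x • u) v = - B u (x • v)` for `x` in `g` and `u`, `v` in `M`. -/
def symmInvariantForms (F g M : Type*) [Field F] [LieRing g] [LieAlgebra F g]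
    [AddCommGroup M] [Module F M] [LieRingModule g M] [LieModule F g M] :
    Submodule F (LinearMap.BilinForm F M) where
  carrier := {B | B.IsSymm ∧ B.lieInvariant g}
  zero_mem' := ⟨⟨fun u v => by simp⟩, fun x u v => by simp⟩
  add_mem' := by
    rintro A B ⟨hA, hA'⟩ ⟨hB, hB'⟩
    refine ⟨hA.add hB, fun x u v => ?_⟩
    rw [LinearMap.add_apply, LinearMap.add_apply, LinearMap.add_apply, LinearMap.add_apply,
      hA' x u v, hB' x u v, neg_add]
  smul_mem' := by
    rintro c B ⟨hB, hB'⟩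
    refine ⟨hB.smul c, fun x u v => ?_⟩
    rw [LinearMap.smul_apply, LinearMap.smul_apply, LinearMap.smul_apply, LinearMap.smul_apply,
      hB' x u v, smul_neg]

section

open LieAlgebra Module

/-! The Killing form κ is nondegenerate, and 𝓛₀ is orthogonal to 𝓛₁. If a submodule U of 𝓛₁ meets
U^⊥ trivially, then [U, U^⊥ ∩ 𝓛₁] = 0, so U + [U, U] is an ideal and U is 0 or 𝓛₁. Hence a reducible
𝓛₁ contains a nonzero totally isotropic submodule N.

Let z ∈ 𝓛₀ represent the functional 2 tr_N through κ. It is central because traces vanish on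
brackets, and the identity κ(n, w) = 2 tr_N [n, w] says that [z, n] = n
(`exists_central_of_isotropic`).

By a Fitting argument, an 𝓛₀-endomorphism that is self-adjoint or skew-adjoint up to scalars is
injective or nilpotent on 𝓛₁ (`exists_pow_eq_zero_of_apply_eq_zero`). So a central element is
determined by its value on one nonzero odd vector, and 1 - (ad z)² is nilpotent on 𝓛₁. The
generalized 1-eigenspace of z is again isotropic, and its central element must be z itself; this
forces (ad z)² = 1 on 𝓛₁. The eigenspaces for 1 and -1 are V and W. They are irreducible because
κ(z, z) = 2 dim N for every nonzero submodule N of either one.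

Reductivity follows from a faithful irreducible module, namely 𝓛₁ or V. For (3), any invariant
symmetric form B has a combination B - cκ with nonzero kernel, and such a degenerate form is zero.
-/

lemma LinearMap.BilinForm.trace_eq_of_isAdjointPair {F M : Type*} [Field F] [AddCommGroup M]
    [Module F M] [FiniteDimensional F M] {B : LinearMap.BilinForm F M} (hB : B.Nondegenerate)
    {S T : End F M} (h : ∀ x y, B (S x) y = B x (T y)) :
    LinearMap.trace F M S = LinearMap.trace F M T := by
  -- The isomorphism of `M` with its dual given by `B` carries `S` to the transpose of `T`.
  have : (B.toDual hB).conj S = Module.Dual.transpose (R := F) T := by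
    ext φ y
    rw [LinearEquiv.conj_apply_apply, LinearMap.BilinForm.toDual_def, h,
      LinearMap.BilinForm.apply_toDual_symm_apply]
    rfl
  rw [← LinearMap.trace_conj' S (B.toDual hB), this, LinearMap.trace_transpose']

namespace GradedLie

/-! ### Parity, and irreducibility as a lattice property -/

section Basic

variable {F L : Type*} [Field F] [LieRing L] [LieAlgebra F L]
  (𝓛 : ZMod 2 → Submodule F L) [GradedLieAlgebra 𝓛]

lemma mem_odd {x : L} : x ∈ odd 𝓛 ↔ x ∈ 𝓛 1 := Iff.rfl

variable {𝓛}

lemma lie_even_even {x y : L} (hx : x ∈ 𝓛 0) (hy : y ∈ 𝓛 0) : ⁅x, y⁆ ∈ 𝓛 0 :=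
  SetLike.GradedBracket.bracket_mem (ℒ := 𝓛) hx hy

lemma lie_even_odd {x y : L} (hx : x ∈ 𝓛 0) (hy : y ∈ 𝓛 1) : ⁅x, y⁆ ∈ 𝓛 1 :=
  SetLike.GradedBracket.bracket_mem (ℒ := 𝓛) hx hy

lemma lie_odd_even {x y : L} (hx : x ∈ 𝓛 1) (hy : y ∈ 𝓛 0) : ⁅x, y⁆ ∈ 𝓛 1 :=
  SetLike.GradedBracket.bracket_mem (ℒ := 𝓛) hx hy

lemma lie_odd_odd {x y : L} (hx : x ∈ 𝓛 1) (hy : y ∈ 𝓛 1) : ⁅x, y⁆ ∈ 𝓛 0 :=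
  SetLike.GradedBracket.bracket_mem (ℒ := 𝓛) hx hy

lemma lie_mem_of_even (U : LieSubmodule F (even 𝓛) L) {x u : L} (hx : x ∈ 𝓛 0) (hu : u ∈ U) :
    ⁅x, u⁆ ∈ U :=
  U.lie_mem (x := ⟨x, hx⟩) hu

variable (𝓛) in
lemma isCompl_even_odd : IsCompl (𝓛 0) (𝓛 1) :=
  (DirectSum.isInternal_submodule_iff_isCompl 𝓛 (i := 0) (j := 1) (by decide)
    (Set.eq_of_subset_of_subset (fun i _ ↦ by fin_cases i; exacts [Or.inl rfl, Or.inr rfl])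
      (Set.subset_univ _))).mp (DirectSum.Decomposition.isInternal 𝓛)

lemma exists_even_add_odd (x : L) : ∃ a ∈ 𝓛 0, ∃ b ∈ 𝓛 1, a + b = x :=
  Submodule.mem_sup.mp ((isCompl_even_odd 𝓛).sup_eq_top ▸ Submodule.mem_top (x := x))

lemma eq_zero_of_even_of_odd {x : L} (h₀ : x ∈ 𝓛 0) (h₁ : x ∈ 𝓛 1) : x = 0 :=
  Submodule.disjoint_def.mp (isCompl_even_odd 𝓛).disjoint x h₀ h₁

lemma eq_bot_of_forall {M g : Type*} [AddCommGroup M] [Module F M] [LieRing g]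
    [LieRingModule g M] {U : LieSubmodule F g M} (h : ∀ u ∈ U, u = 0) : U = ⊥ :=
  (LieSubmodule.eq_bot_iff U).mpr h

lemma exists_mem_ne_zero {M g : Type*} [AddCommGroup M] [Module F M] [LieRing g]
    [LieRingModule g M] {U : LieSubmodule F g M} (h : U ≠ ⊥) : ∃ u ∈ U, u ≠ 0 := by
  contrapose! h
  exact eq_bot_of_forall h

/-- This allows all submodules to be compared in the single lattice of submodules of `L`. -/
lemma isIrreducible_iff_isAtom {M g : Type*} [AddCommGroup M] [Module F M] [LieRing g]
    [LieRingModule g M] (U : LieSubmodule F g M) :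
    LieModule.IsIrreducible F g U ↔ IsAtom U := by
  have hinj : Function.Injective (LieSubmodule.map U.incl) :=
    LieSubmodule.map_injective_of_injective U.injective_incl
  constructor
  · intro h
    refine ⟨fun hU ↦ ?_, fun N hN ↦ ?_⟩
    · have := LieModule.nontrivial_of_isIrreducible F g U
      exact (LieSubmodule.nontrivial_iff_ne_bot F g M).mp this hU
    · rcases h.eq_bot_or_eq_top (N.comap U.incl) with h' | h'
      · rw [LieSubmodule.comap_incl_eq_bot] at h'
        rwa [inf_eq_right.mpr hN.le] at h'
      · exact absurd (LieSubmodule.comap_incl_eq_top.mp h') hN.not_ge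
  · intro h
    have : Nontrivial U := (LieSubmodule.nontrivial_iff_ne_bot F g M).mpr h.1
    refine LieModule.IsIrreducible.mk fun N hN ↦ ?_
    refine hinj ?_
    rw [LieSubmodule.map_incl_top]
    rcases h.le_iff.mp (LieSubmodule.map_incl_le (N := U) (N' := N)) with h' | h'
    · exact absurd (hinj (h'.trans (LieSubmodule.map_bot).symm)) hN
    · exact h'

end Basic

/-! ### Orthogonality for the Killing form -/

section Killing

variable {F L : Type*} [Field F] [LieRing L] [LieAlgebra F L]
  {𝓛 : ZMod 2 → Submodule F L} [GradedLieAlgebra 𝓛]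

lemma killingForm_lie (x y z : L) : killingForm F L ⁅x, y⁆ z = - killingForm F L y ⁅x, z⁆ :=
  LieModule.traceForm_lieInvariant F L L x y z

lemma killingForm_comm (x y : L) : killingForm F L x y = killingForm F L y x :=
  LieModule.traceForm_comm F L L x y

lemma eq_zero_of_killingForm [IsKilling F L] {x : L} (h : ∀ y, killingForm F L x y = 0) : x = 0 :=
  (IsKilling.killingForm_nondegenerate F L).1 x h

variable (𝓛) in
/-- The orthogonal complement in the odd part, with respect to the Killing form, of a submodule. -/
def oddOrthogonal (U : LieSubmodule F (even 𝓛) L) : LieSubmodule F (even 𝓛) L where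
  carrier := {v | v ∈ 𝓛 1 ∧ ∀ u ∈ U, killingForm F L u v = 0}
  zero_mem' := ⟨zero_mem _, by simp⟩
  add_mem' := fun ha hb ↦ ⟨add_mem ha.1 hb.1, fun u hu ↦ by
    rw [map_add, ha.2 u hu, hb.2 u hu, add_zero]⟩
  smul_mem' := fun c x hx ↦ ⟨Submodule.smul_mem _ c hx.1, fun u hu ↦ by
    rw [map_smul, hx.2 u hu, smul_zero]⟩
  lie_mem := by
    rintro ⟨x, hx⟩ v ⟨hv, h⟩
    refine ⟨lie_even_odd hx hv, fun u hu ↦ ?_⟩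
    change killingForm F L u ⁅x, v⁆ = 0
    rw [← neg_eq_zero, ← killingForm_lie, h _ (lie_mem_of_even U hx hu)]

variable [FiniteDimensional F L]

lemma sup_oddOrthogonal_eq {U : LieSubmodule F (even 𝓛) L} (hU : U ≤ odd 𝓛)
    (h : U ⊓ oddOrthogonal 𝓛 U = ⊥) : U ⊔ oddOrthogonal 𝓛 U = odd 𝓛 := by
  refine le_antisymm (sup_le hU fun v hv ↦ hv.1) fun v hv ↦ ?_
  have hdisj : Disjoint U.toSubmodule ((killingForm F L).orthogonal U.toSubmodule) := by
    refine Submodule.disjoint_def.mpr fun u hu hu' ↦ ?_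
    have : u ∈ U ⊓ oddOrthogonal 𝓛 U := ⟨hu, hU hu, fun w hw ↦ hu' w hw⟩
    rwa [h, LieSubmodule.mem_bot] at this
  have hcompl := (LinearMap.BilinForm.isCompl_orthogonal_iff_disjoint
    (LieModule.traceForm_isSymm F L L).isRefl).mpr hdisj
  obtain ⟨u, hu, w, hw, rfl⟩ := Submodule.mem_sup.mp
    (hcompl.sup_eq_top ▸ Submodule.mem_top (x := v))
  refine add_mem (LieSubmodule.mem_sup_left hu)
    (LieSubmodule.mem_sup_right ⟨?_, fun u' hu' ↦ hw u' hu'⟩)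
  -- The orthogonal complement in `L` also contains even elements; `w` is odd as the difference of
  -- `v` and `u`.
  exact (Submodule.add_mem_iff_right _ (hU hu)).mp hv

lemma trace_eq_zero_of_swap {T : End F L} (h₀ : ∀ x ∈ 𝓛 0, T x ∈ 𝓛 1)
    (h₁ : ∀ x ∈ 𝓛 1, T x ∈ 𝓛 0) : LinearMap.trace F L T = 0 := by
  refine LinearMap.trace_eq_zero_of_mapsTo_ne (DirectSum.Decomposition.isInternal 𝓛)
    (fun i ↦ i + 1) (by decide) fun i ↦ ?_
  fin_cases i
  · exact h₀
  · exact h₁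

lemma killingForm_even_odd {x y : L} (hx : x ∈ 𝓛 0) (hy : y ∈ 𝓛 1) :
    killingForm F L x y = 0 := by
  rw [killingForm_apply_apply]
  exact trace_eq_zero_of_swap (𝓛 := 𝓛)
    (fun z hz ↦ lie_even_odd hx (lie_odd_even hy hz))
    (fun z hz ↦ lie_even_even hx (lie_odd_odd hy hz))

lemma killingForm_odd_even {x y : L} (hx : x ∈ 𝓛 1) (hy : y ∈ 𝓛 0) :
    killingForm F L x y = 0 := by
  rw [killingForm_comm, killingForm_even_odd hy hx]

variable [IsKilling F L]

lemma eq_zero_of_even {x : L} (hx : x ∈ 𝓛 0) (h : ∀ y ∈ 𝓛 0, killingForm F L x y = 0) :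
    x = 0 := by
  refine eq_zero_of_killingForm (F := F) fun y ↦ ?_
  obtain ⟨a, ha, b, hb, rfl⟩ := exists_even_add_odd (𝓛 := 𝓛) y
  rw [map_add, h a ha, killingForm_even_odd hx hb, add_zero]

lemma eq_zero_of_odd {x : L} (hx : x ∈ 𝓛 1) (h : ∀ y ∈ 𝓛 1, killingForm F L x y = 0) :
    x = 0 := by
  refine eq_zero_of_killingForm (F := F) fun y ↦ ?_
  obtain ⟨a, ha, b, hb, rfl⟩ := exists_even_add_odd (𝓛 := 𝓛) y
  rw [map_add, h b hb, killingForm_odd_even hx ha, add_zero]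

/-- For even x, κ([u, v], x) = κ([x, u], v) = 0, and κ is nondegenerate on the even part. -/
lemma lie_eq_zero_of_orthogonal {U : LieSubmodule F (even 𝓛) L} (hU : U ≤ odd 𝓛) {u v : L}
    (hu : u ∈ U) (hv : v ∈ 𝓛 1) (h : ∀ u' ∈ U, killingForm F L u' v = 0) : ⁅u, v⁆ = 0 := by
  refine eq_zero_of_even (lie_odd_odd (hU hu) hv) fun x hx ↦ ?_
  rw [LieModule.traceForm_apply_lie_apply, ← lie_skew, map_neg, ← killingForm_lie,
    h _ (lie_mem_of_even U hx hu)]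

end Killing

/-! ### Faithfulness of the odd part -/

section Faithful

variable {F L : Type*} [Field F] [LieRing L] [LieAlgebra F L] [LieAlgebra.IsSimple F L]
  {𝓛 : ZMod 2 → Submodule F L} [GradedLieAlgebra 𝓛]

/-- The annihilator of 𝓛₁ in 𝓛₀ is an ideal of `L`, and it is proper because 𝓛₁ is nonzero. -/
lemma eq_zero_of_lie_odd_eq_zero (hodd : 𝓛 1 ≠ ⊥) {x : L} (hx : x ∈ 𝓛 0)
    (h : ∀ v ∈ 𝓛 1, ⁅x, v⁆ = 0) : x = 0 := by
  let I : LieIdeal F L :=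
    { carrier := {x | x ∈ 𝓛 0 ∧ ∀ v ∈ 𝓛 1, ⁅x, v⁆ = 0}
      zero_mem' := ⟨zero_mem _, by simp⟩
      add_mem' := fun ha hb ↦ ⟨add_mem ha.1 hb.1, fun v hv ↦ by
        rw [add_lie, ha.2 v hv, hb.2 v hv, add_zero]⟩
      smul_mem' := fun c x hx ↦ ⟨Submodule.smul_mem _ c hx.1, fun v hv ↦ by
        rw [smul_lie, hx.2 v hv, smul_zero]⟩
      lie_mem := by
        rintro y x ⟨hx, h⟩
        obtain ⟨a, ha, b, hb, rfl⟩ := exists_even_add_odd (𝓛 := 𝓛) y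
        have : ⁅a + b, x⁆ = ⁅a, x⁆ := by rw [add_lie, ← lie_skew b x, h b hb, neg_zero, add_zero]
        change ⁅a + b, x⁆ ∈ 𝓛 0 ∧ ∀ v ∈ 𝓛 1, ⁅⁅a + b, x⁆, v⁆ = 0
        rw [this]
        refine ⟨lie_even_even ha hx, fun v hv ↦ ?_⟩
        rw [lie_lie, h v hv, h _ (lie_even_odd ha hv), lie_zero, sub_zero] }
  have hmem : ∀ x, x ∈ I ↔ x ∈ 𝓛 0 ∧ ∀ v ∈ 𝓛 1, ⁅x, v⁆ = 0 := fun x ↦ Iff.rfl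
  rcases IsSimple.eq_bot_or_eq_top (R := F) I with hI | hI
  · have : x ∈ I := (hmem x).mpr ⟨hx, h⟩
    rwa [hI, LieSubmodule.mem_bot] at this
  · refine absurd ((Submodule.eq_bot_iff _).mpr fun v hv ↦ ?_) hodd
    have : v ∈ I := hI ▸ LieSubmodule.mem_top v
    exact eq_zero_of_even_of_odd ((hmem v).mp this).1 hv

end Faithful

/-! ### Isotropic submodules from reducibility -/

section Simple

variable {F L : Type*} [Field F] [CharZero F] [LieRing L] [LieAlgebra F L] [FiniteDimensional F L]
  [LieAlgebra.IsSimple F L] {𝓛 : ZMod 2 → Submodule F L} [GradedLieAlgebra 𝓛]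

/-- A nonzero submodule of the odd part which meets its orthogonal complement trivially is the
whole odd part. -/
lemma eq_odd_of_inf_oddOrthogonal {U : LieSubmodule F (even 𝓛) L} (hU : U ≤ odd 𝓛) (hU₀ : U ≠ ⊥)
    (h : U ⊓ oddOrthogonal 𝓛 U = ⊥) : U = odd 𝓛 := by
  have hdec : ∀ v ∈ 𝓛 1, ∃ u ∈ U, ∃ w ∈ oddOrthogonal 𝓛 U, u + w = v := fun v hv ↦ by
    rw [← mem_odd, ← sup_oddOrthogonal_eq hU h] at hv
    exact (LieSubmodule.mem_sup _ _ _).mp hv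
  let S : Submodule F L := Submodule.span F {x | ∃ u ∈ U, ∃ v ∈ U, ⁅u, v⁆ = x}
  have hS₀ : S ≤ 𝓛 0 := Submodule.span_le.mpr <| by
    rintro _ ⟨u, hu, v, hv, rfl⟩
    exact lie_odd_odd (hU hu) (hU hv)
  have hS : ∀ u ∈ U, ∀ v ∈ U, ⁅u, v⁆ ∈ S := fun u hu v hv ↦
    Submodule.subset_span ⟨u, hu, v, hv, rfl⟩
  have hUw : ∀ w ∈ oddOrthogonal 𝓛 U, ∀ u ∈ U, ⁅w, u⁆ = 0 := fun w hw u hu ↦ by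
    rw [← lie_skew, lie_eq_zero_of_orthogonal hU hu hw.1 hw.2, neg_zero]
  -- U + [U, U] is an ideal: the orthogonal part of 𝓛₁ kills U, hence kills [U, U] by the Jacobi
  -- identity.
  have key : ∀ x : L, ∀ s ∈ S, ⁅x, s⁆ ∈ U.toSubmodule ⊔ S := by
    intro x s hs
    induction hs using Submodule.span_induction with
    | mem s hs =>
      obtain ⟨u, hu, v, hv, rfl⟩ := hs
      obtain ⟨a, ha, b, hb, rfl⟩ := exists_even_add_odd (𝓛 := 𝓛) x
      obtain ⟨b, hb', w, hw, rfl⟩ := hdec b hb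
      rw [add_lie, add_lie]
      refine add_mem ?_ (add_mem ?_ ?_)
      · rw [leibniz_lie]
        exact Submodule.mem_sup_right (add_mem (hS _ (lie_mem_of_even U ha hu) _ hv)
          (hS _ hu _ (lie_mem_of_even U ha hv)))
      · rw [← lie_skew b]
        exact Submodule.mem_sup_left (neg_mem
          (lie_mem_of_even U (lie_odd_odd (hU hu) (hU hv)) hb'))
      · rw [leibniz_lie, hUw w hw u hu, hUw w hw v hv, zero_lie, lie_zero, add_zero]
        exact zero_mem _
    | zero => simp
    | add s t _ _ hs ht => rw [lie_add]; exact add_mem hs ht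
    | smul c s _ hs => rw [lie_smul]; exact Submodule.smul_mem _ _ hs
  let I : LieIdeal F L :=
    { __ := U.toSubmodule ⊔ S
      lie_mem := by
        intro x m hm
        change m ∈ U.toSubmodule ⊔ S at hm
        change ⁅x, m⁆ ∈ U.toSubmodule ⊔ S
        obtain ⟨u, hu, s, hs, rfl⟩ := Submodule.mem_sup.mp hm
        rw [lie_add]
        refine add_mem ?_ (key x s hs)
        obtain ⟨a, ha, b, hb, rfl⟩ := exists_even_add_odd (𝓛 := 𝓛) x
        obtain ⟨b, hb', w, hw, rfl⟩ := hdec b hb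
        rw [add_lie, add_lie, hUw w hw u hu, add_zero]
        exact add_mem (Submodule.mem_sup_left (lie_mem_of_even U ha hu))
          (Submodule.mem_sup_right (hS b hb' u hu)) }
  have hmem : ∀ x, x ∈ I ↔ x ∈ U.toSubmodule ⊔ S := fun x ↦ Iff.rfl
  rcases IsSimple.eq_bot_or_eq_top (R := F) I with hI | hI
  · refine absurd (eq_bot_of_forall fun u hu ↦ ?_) hU₀
    have : u ∈ I := (hmem u).mpr (Submodule.mem_sup_left hu)
    rwa [hI, LieSubmodule.mem_bot] at this
  · refine le_antisymm hU fun v hv ↦ ?_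
    have : v ∈ I := hI ▸ LieSubmodule.mem_top v
    obtain ⟨u, hu, s, hs, rfl⟩ := Submodule.mem_sup.mp ((hmem v).mp this)
    have hs1 : s ∈ 𝓛 1 := (Submodule.add_mem_iff_right _ (hU hu)).mp hv
    rw [eq_zero_of_even_of_odd (hS₀ hs) hs1, add_zero]
    exact hu

/-- If the odd part is reducible, then it has a nonzero totally isotropic submodule. -/
lemma exists_isotropic (hodd : 𝓛 1 ≠ ⊥) (h : ¬ LieModule.IsIrreducible F (even 𝓛) (odd 𝓛)) :
    ∃ N : LieSubmodule F (even 𝓛) L, N ≤ odd 𝓛 ∧ N ≠ ⊥ ∧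
      ∀ x ∈ N, ∀ y ∈ N, killingForm F L x y = 0 := by
  rw [isIrreducible_iff_isAtom, IsAtom, not_and_or] at h
  have h₀ : odd 𝓛 ≠ ⊥ := fun h ↦ hodd (by
    refine (Submodule.eq_bot_iff _).mpr fun x hx ↦ ?_
    exact (LieSubmodule.eq_bot_iff _).mp h x hx)
  obtain ⟨U, hU, hU₀⟩ : ∃ U < odd 𝓛, U ≠ ⊥ := by simpa [h₀] using h
  refine ⟨U ⊓ oddOrthogonal 𝓛 U, inf_le_left.trans hU.le,
    fun hN ↦ hU.ne (eq_odd_of_inf_oddOrthogonal hU.le hU₀ hN), fun x hx y hy ↦ ?_⟩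
  exact hy.2.2 x hx.1

end Simple

/-! ### The central element attached to an isotropic submodule -/

section Killing

variable {F L : Type*} [Field F] [LieRing L] [LieAlgebra F L]
  {𝓛 : ZMod 2 → Submodule F L} [GradedLieAlgebra 𝓛]

variable (𝓛) in
/-- The projection of a graded Lie algebra to its odd part. -/
noncomputable def oddProj : End F L := Submodule.projection _ _ (isCompl_even_odd 𝓛).symm

lemma oddProj_add {a b : L} (ha : a ∈ 𝓛 0) (hb : b ∈ 𝓛 1) : oddProj 𝓛 (a + b) = b := by
  rw [oddProj, map_add, (Submodule.projection_apply_eq_zero_iff _).mpr ha,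
    Submodule.projection_apply_of_mem_left _ hb, zero_add]

variable [FiniteDimensional F L]

/-- For odd `x` and `y`, the Killing form is computed by the traces of `ad x ∘ ad y` on the odd
part of the algebra. -/
lemma killingForm_eq_two_mul_trace [IsKilling F L] {x y : L} (hx : x ∈ 𝓛 1) (hy : y ∈ 𝓛 1) :
    killingForm F L x y =
      2 * LinearMap.trace F L (ad F L x * ad F L y * oddProj 𝓛) := by
  set A := ad F L x
  set B := ad F L y
  set P := oddProj 𝓛
  have hP : ∀ a ∈ 𝓛 0, P a = 0 := fun a ha ↦ by simpa using oddProj_add ha (zero_mem (𝓛 1))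
  have hP' : ∀ b ∈ 𝓛 1, P b = b := fun b hb ↦ by simpa using oddProj_add (zero_mem (𝓛 0)) hb
  -- The two summands are the contributions of 𝓛₁ and 𝓛₀ to the trace. They are equal, by
  -- adjointness (`h2`) and cyclicity (`h3`).
  have h1 : A * B = A * B * P + A * (P * B) := by
    ext v
    obtain ⟨a, ha, b, hb, rfl⟩ := exists_even_add_odd (𝓛 := 𝓛) v
    have e1 : B a ∈ 𝓛 1 := lie_odd_even hy ha
    have e2 : B b ∈ 𝓛 0 := lie_odd_odd hy hb
    simp [hP a ha, hP' b hb, hP' _ e1, hP _ e2, add_comm]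
  have h2 : LinearMap.trace F L (A * B * P) = LinearMap.trace F L (P * (B * A)) := by
    refine LinearMap.BilinForm.trace_eq_of_isAdjointPair
      (IsKilling.killingForm_nondegenerate F L) fun v w ↦ ?_
    obtain ⟨a, ha, b, hb, rfl⟩ := exists_even_add_odd (𝓛 := 𝓛) v
    obtain ⟨c, hc, d, hd, rfl⟩ := exists_even_add_odd (𝓛 := 𝓛) w
    have e1 : B (A c) ∈ 𝓛 0 := lie_odd_odd hy (lie_odd_even hx hc)
    have e2 : B (A d) ∈ 𝓛 1 := lie_odd_even hy (lie_odd_odd hx hd)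
    have e3 : A (B b) ∈ 𝓛 1 := lie_odd_even hx (lie_odd_odd hy hb)
    simp only [End.mul_apply, map_add, hP a ha, hP' b hb, hP _ e1, hP' _ e2, LinearMap.add_apply,
      killingForm_odd_even e3 hc, killingForm_even_odd ha e2, map_zero,
      zero_add]
    simp only [A, B, ad_apply, killingForm_lie, neg_neg]
  have h3 : LinearMap.trace F L (A * (P * B)) = LinearMap.trace F L (P * (B * A)) := by
    rw [LinearMap.trace_mul_comm, mul_assoc]
  rw [killingForm_apply_apply]
  refine (congr_arg (LinearMap.trace F L) h1).trans ?_
  rw [map_add, h3, ← h2, two_mul]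

/-- If `N` is a totally isotropic submodule of the odd part, then twice the character of `N`
computes the Killing form between `N` and the odd part. -/
lemma killingForm_eq_two_mul_trace_of_isotropic [IsKilling F L] {N : LieSubmodule F (even 𝓛) L}
    (hN : N ≤ odd 𝓛) (hiso : ∀ x ∈ N, ∀ y ∈ N, killingForm F L x y = 0) {n w : L} (hn : n ∈ N)
    (hw : w ∈ 𝓛 1) :
    killingForm F L n w =
      2 * LinearMap.trace F N
        (LieModule.toEnd F (even 𝓛) N ⟨⁅n, w⁆, lie_odd_odd (hN hn) hw⟩) := by
  rw [killingForm_eq_two_mul_trace (hN hn) hw]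
  congr 1
  -- The operator has image in N, so its trace can be taken there. On N it is ad [n, w], since [N,
  -- N] = 0.
  have hmem : ∀ v, (ad F L n * ad F L w * oddProj 𝓛) v ∈ N.toSubmodule := fun v ↦ by
    obtain ⟨a, ha, b, hb, rfl⟩ := exists_even_add_odd (𝓛 := 𝓛) v
    rw [End.mul_apply, oddProj_add ha hb]
    change ⁅n, ⁅w, b⁆⁆ ∈ N
    rw [← lie_skew]
    exact neg_mem (lie_mem_of_even N (lie_odd_odd hw hb) hn)
  rw [← LinearMap.trace_restrict_eq_of_forall_mem _ _ hmem]
  congr 1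
  ext ⟨v, hv⟩
  have hv' : oddProj 𝓛 v = v := by simpa using oddProj_add (zero_mem (𝓛 0)) (hN hv)
  change ⁅n, ⁅w, oddProj 𝓛 v⁆⁆ = ⁅⁅n, w⁆, v⁆
  rw [hv', lie_lie, lie_eq_zero_of_orthogonal hN hn (hN hv) fun u hu ↦ hiso u hu v hv, lie_zero,
    sub_zero]

/-- A totally isotropic submodule `N` of the odd part gives rise to a central element of the even
part which acts as the identity on `N`. It is the element which represents twice the character of
`N` with respect to the Killing form. -/
lemma exists_central_of_isotropic [IsKilling F L] {N : LieSubmodule F (even 𝓛) L}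
    (hN : N ≤ odd 𝓛) (hiso : ∀ x ∈ N, ∀ y ∈ N, killingForm F L x y = 0) :
    ∃ z ∈ 𝓛 0, (∀ x ∈ 𝓛 0, ⁅z, x⁆ = 0) ∧ (∀ n ∈ N, ⁅z, n⁆ = n) ∧
      ∀ x : even 𝓛,
        killingForm F L z x = 2 * LinearMap.trace F N (LieModule.toEnd F (even 𝓛) N x) := by
  let τ : even 𝓛 →ₗ[F] F := LinearMap.trace F N ∘ₗ (LieModule.toEnd F (even 𝓛) N : _ →ₗ[F] _)
  let π : L →ₗ[F] even 𝓛 := (𝓛 0).projectionOnto (𝓛 1) (isCompl_even_odd 𝓛)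
  -- The functional 2 tr_N is extended by zero to the odd part, which makes z even.
  obtain ⟨z, hz⟩ := ((killingForm F L).toDual
    (IsKilling.killingForm_nondegenerate F L)).surjective ((2 : F) • (τ ∘ₗ π))
  replace hz : ∀ x, killingForm F L z x = 2 * τ (π x) := fun x ↦ by
    rw [← LinearMap.BilinForm.toDual_def (IsKilling.killingForm_nondegenerate F L), hz]
    rfl
  have hz₁ : ∀ x ∈ 𝓛 1, killingForm F L z x = 0 := fun x hx ↦ by
    have : π x = 0 := (Submodule.projectionOnto_apply_eq_zero_iff _).mpr hx
    rw [hz, this, map_zero, mul_zero]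
  have hz₀ : ∀ x : even 𝓛, killingForm F L z x = 2 * τ x := fun x ↦ by
    rw [hz]
    exact congr_arg (fun y ↦ 2 * τ y) (Submodule.projectionOnto_apply_left _ x)
  have hmem : z ∈ 𝓛 0 := by
    obtain ⟨a, ha, b, hb, rfl⟩ := exists_even_add_odd (𝓛 := 𝓛) z
    have : b = 0 := eq_zero_of_odd hb fun y hy ↦ by
      simpa [killingForm_even_odd ha hy] using hz₁ y hy
    rwa [this, add_zero]
  refine ⟨z, hmem, fun x hx ↦ eq_zero_of_even (lie_even_even hmem hx) fun y hy ↦ ?_, fun n hn ↦ ?_,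
    hz₀⟩
  · rw [LieModule.traceForm_apply_lie_apply]
    refine (hz₀ ⁅(⟨x, hx⟩ : even 𝓛), (⟨y, hy⟩ : even 𝓛)⁆).trans ?_
    simp only [τ, LinearMap.comp_apply, LieHom.coe_toLinearMap, LieHom.map_lie,
      LinearMap.trace_lie, mul_zero]
  -- κ([z, n], w) = κ(z, [n, w]) = 2 tr_N [n, w] = κ(n, w) for all odd w.
  · refine sub_eq_zero.mp (eq_zero_of_odd (𝓛 := 𝓛)
      (sub_mem (lie_even_odd hmem (hN hn)) (hN hn)) fun w hw ↦ ?_)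
    rw [map_sub, LinearMap.sub_apply, LieModule.traceForm_apply_lie_apply,
      hz₀ ⟨⁅n, w⁆, lie_odd_odd (hN hn) hw⟩]
    refine sub_eq_zero.mpr ?_
    rw [killingForm_eq_two_mul_trace_of_isotropic hN hiso hn hw]
    rfl

end Killing

/-! ### Rigidity of central elements -/

section Simple

variable {F L : Type*} [Field F] [CharZero F] [LieRing L] [LieAlgebra F L] [FiniteDimensional F L]
  [LieAlgebra.IsSimple F L] {𝓛 : ZMod 2 → Submodule F L} [GradedLieAlgebra 𝓛]

/-- An endomorphism of the odd part which commutes with the even part, and is self-adjoint or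
skew-adjoint with respect to the Killing form, is injective or nilpotent. -/
lemma exists_pow_eq_zero_of_apply_eq_zero {T : End F L} (h₀ : ∀ x ∈ 𝓛 0, T x ∈ 𝓛 0)
    (h₁ : ∀ x ∈ 𝓛 1, T x ∈ 𝓛 1) (hcomm : ∀ x ∈ 𝓛 0, ∀ v, T ⁅x, v⁆ = ⁅x, T v⁆) {ε : F}
    (hadj : ∀ x y, killingForm F L (T x) y = ε * killingForm F L x (T y))
    {v : L} (hv : v ∈ 𝓛 1) (hv₀ : v ≠ 0) (hTv : T v = 0) :
    ∃ k, ∀ w ∈ 𝓛 1, (T ^ k) w = 0 := by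
  -- Fitting decomposition of `T`; the bound k ≥ 1 puts v in the kernel of T ^ k.
  obtain ⟨k, hk, hk'⟩ := ((LinearMap.eventually_isCompl_ker_pow_range_pow T).and
    (Filter.eventually_ge_atTop 1)).exists
  have hk₀ : ∀ i, ∀ x ∈ 𝓛 0, (T ^ i) x ∈ 𝓛 0 := fun i ↦ by
    induction i with
    | zero => simp
    | succ i ih => exact fun x hx ↦ by rw [pow_succ']; exact h₀ _ (ih x hx)
  have hk₁ : ∀ i, ∀ x ∈ 𝓛 1, (T ^ i) x ∈ 𝓛 1 := fun i ↦ by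
    induction i with
    | zero => simp
    | succ i ih => exact fun x hx ↦ by rw [pow_succ']; exact h₁ _ (ih x hx)
  have hkc : ∀ i, ∀ x ∈ 𝓛 0, ∀ v, (T ^ i) ⁅x, v⁆ = ⁅x, (T ^ i) v⁆ := fun i ↦ by
    induction i with
    | zero => simp
    | succ i ih =>
      intro x hx v
      rw [pow_succ', End.mul_apply, End.mul_apply, ih x hx, hcomm x hx]
  have hka : ∀ i, ∀ x y, killingForm F L ((T ^ i) x) y =
      ε ^ i * killingForm F L x ((T ^ i) y) := fun i ↦ by
    induction i with
    | zero => simp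
    | succ i ih =>
      intro x y
      rw [pow_succ, End.mul_apply, ih, hadj, pow_succ, mul_assoc, ← pow_succ T, pow_succ' T,
        End.mul_apply]
  let U : LieSubmodule F (even 𝓛) L :=
    { __ := 𝓛 1 ⊓ LinearMap.ker (T ^ k)
      lie_mem := by
        rintro ⟨x, hx⟩ m ⟨hm, hm'⟩
        refine ⟨lie_even_odd hx hm, ?_⟩
        change (T ^ k) ⁅x, m⁆ = 0
        rw [hkc k x hx, LinearMap.mem_ker.mp hm', lie_zero] }
  have hmem : ∀ u, u ∈ U ↔ u ∈ 𝓛 1 ∧ (T ^ k) u = 0 := fun u ↦ Iff.rfl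
  have hU : U ≤ odd 𝓛 := fun u hu ↦ hu.1
  have hU₀ : U ≠ ⊥ := fun h ↦ hv₀ <| (LieSubmodule.eq_bot_iff U).mp h v <| (hmem v).mpr ⟨hv, by
    obtain ⟨j, rfl⟩ := Nat.exists_eq_add_of_le' hk'
    rw [pow_succ, End.mul_apply, hTv, map_zero]⟩
  -- By adjointness ker T ^ k is orthogonal to range T ^ k, so an element of U orthogonal to U is
  -- orthogonal to all of 𝓛₁.
  have hU' : U ⊓ oddOrthogonal 𝓛 U = ⊥ := by
    refine eq_bot_of_forall fun u hu ↦ ?_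
    obtain ⟨hu, -, huU⟩ := hu
    obtain ⟨hu₁, huk⟩ := (hmem u).mp hu
    refine eq_zero_of_odd (F := F) hu₁ fun w hw ↦ ?_
    obtain ⟨a, ha, _, ⟨c, rfl⟩, rfl⟩ := Submodule.mem_sup.mp
      (hk.sup_eq_top ▸ Submodule.mem_top (x := w))
    have hc : killingForm F L u ((T ^ k) c) = 0 := by
      rw [killingForm_comm, hka, huk, map_zero, mul_zero]
    rw [map_add, hc, add_zero]
    obtain ⟨a, ha₀, b, hb, rfl⟩ := exists_even_add_odd (𝓛 := 𝓛) a
    have hb0 : (T ^ k) b = 0 := by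
      refine eq_zero_of_even_of_odd (𝓛 := 𝓛) ?_ (hk₁ k b hb)
      rw [LinearMap.mem_ker, map_add] at ha
      rw [eq_neg_of_add_eq_zero_right ha]
      exact neg_mem (hk₀ k a ha₀)
    rw [map_add, killingForm_odd_even hu₁ ha₀, zero_add, killingForm_comm,
      huU b ((hmem b).mpr ⟨hb, hb0⟩)]
  refine ⟨k, fun w hw ↦ ?_⟩
  have : w ∈ U := by rw [eq_odd_of_inf_oddOrthogonal hU hU₀ hU']; exact hw
  exact ((hmem w).mp this).2

/-- A central element of the even part which kills a nonzero odd element is zero. -/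
lemma eq_zero_of_central {z v : L} (hz : z ∈ 𝓛 0) (hzc : ∀ x ∈ 𝓛 0, ⁅z, x⁆ = 0)
    (hv : v ∈ 𝓛 1) (hv₀ : v ≠ 0) (hzv : ⁅z, v⁆ = 0) : z = 0 := by
  have hcomm : ∀ x ∈ 𝓛 0, ∀ v, ad F L z ⁅x, v⁆ = ⁅x, ad F L z v⁆ := fun x hx v ↦ by
    rw [ad_apply, ad_apply, leibniz_lie, hzc x hx, zero_lie, zero_add]
  obtain ⟨k, hk⟩ := exists_pow_eq_zero_of_apply_eq_zero (T := ad F L z) (ε := -1)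
    (fun x hx ↦ lie_even_even hz hx) (fun x hx ↦ lie_even_odd hz hx) hcomm
    (fun x y ↦ by rw [ad_apply, ad_apply, killingForm_lie, neg_one_mul]) hv hv₀ hzv
  have hnil : IsNilpotent (ad F L z) := by
    refine ⟨k + 1, ?_⟩
    ext w
    obtain ⟨a, ha, b, hb, rfl⟩ := exists_even_add_odd (𝓛 := 𝓛) w
    rw [pow_succ, End.mul_apply, map_add, ad_apply, hzc a ha, zero_add, ad_apply,
      hk _ (lie_even_odd hz hb), LinearMap.zero_apply]
  refine eq_zero_of_even (F := F) hz fun x hx ↦ ?_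
  -- The product of a nilpotent operator with one commuting with it is nilpotent, so κ(z, x) = 0.
  have : Commute (ad F L z) (ad F L x) := by
    ext w
    exact hcomm x hx w
  rw [killingForm_apply_apply]
  exact (LinearMap.isNilpotent_trace_of_isNilpotent (this.isNilpotent_mul_right hnil)).eq_zero

end Simple

/-! ### Eigenspaces of central elements -/

section Eigenspace

variable {F L : Type*} [Field F] [LieRing L] [LieAlgebra F L]
  {𝓛 : ZMod 2 → Submodule F L} [GradedLieAlgebra 𝓛]

lemma odd_ne_bot (hodd : 𝓛 1 ≠ ⊥) : odd 𝓛 ≠ ⊥ := fun h ↦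
  hodd ((Submodule.eq_bot_iff _).mpr fun x hx ↦ (LieSubmodule.eq_bot_iff _).mp h x hx)

/-- An element of the even part acting as a nonzero scalar on a submodule forces that submodule
to be totally isotropic. -/
lemma isotropic_of_lie_eq_smul [CharZero F] {z : L} {c : F} (hc : c ≠ 0) {N : LieSubmodule F (even 𝓛) L}
    (h : ∀ x ∈ N, ⁅z, x⁆ = c • x) : ∀ x ∈ N, ∀ y ∈ N, killingForm F L x y = 0 := by
  intro x hx y hy
  have := killingForm_lie (F := F) z x y
  rw [h x hx, h y hy, map_smul, map_smul, LinearMap.smul_apply, eq_neg_iff_add_eq_zero,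
    ← two_smul F, smul_smul, smul_eq_mul] at this
  exact (mul_eq_zero.mp this).resolve_left (mul_ne_zero two_ne_zero hc)

variable (𝓛) in
/-- The eigenspace in the odd part of a central element of the even part. -/
def oddEigenspace {z : L} (hzc : ∀ x ∈ 𝓛 0, ⁅z, x⁆ = 0) (c : F) :
    LieSubmodule F (even 𝓛) L where
  __ := 𝓛 1 ⊓ End.eigenspace (ad F L z) c
  lie_mem := by
    rintro ⟨x, hx⟩ v ⟨hv, hv'⟩
    refine ⟨lie_even_odd hx hv, ?_⟩
    replace hv' : ⁅z, v⁆ = c • v := End.mem_eigenspace_iff.mp hv'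
    refine End.mem_eigenspace_iff.mpr ?_
    change ⁅z, ⁅x, v⁆⁆ = c • ⁅x, v⁆
    rw [leibniz_lie, hzc x hx, zero_lie, zero_add, hv', lie_smul]

lemma mem_oddEigenspace {z : L} {hzc : ∀ x ∈ 𝓛 0, ⁅z, x⁆ = 0} {c : F} {v : L} :
    v ∈ oddEigenspace 𝓛 hzc c ↔ v ∈ 𝓛 1 ∧ ⁅z, v⁆ = c • v :=
  and_congr Iff.rfl End.mem_eigenspace_iff

end Eigenspace

/-! ### The splitting of a reducible odd part -/

section Splitting

variable {F L : Type*} [Field F] [CharZero F] [LieRing L] [LieAlgebra F L] [FiniteDimensional F L]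
  [LieAlgebra.IsSimple F L] {𝓛 : ZMod 2 → Submodule F L} [GradedLieAlgebra 𝓛]

lemma ne_odd_of_isotropic (hodd : 𝓛 1 ≠ ⊥) {N : LieSubmodule F (even 𝓛) L}
    (hiso : ∀ x ∈ N, ∀ y ∈ N, killingForm F L x y = 0) : N ≠ odd 𝓛 := by
  rintro rfl
  exact odd_ne_bot hodd (eq_bot_of_forall fun u hu ↦
    eq_zero_of_odd (F := F) (𝓛 := 𝓛) hu fun y hy ↦ hiso u hu y hy)

lemma eq_of_central {y z v : L} (hy : y ∈ 𝓛 0) (hyc : ∀ x ∈ 𝓛 0, ⁅y, x⁆ = 0) (hz : z ∈ 𝓛 0)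
    (hzc : ∀ x ∈ 𝓛 0, ⁅z, x⁆ = 0) (hv : v ∈ 𝓛 1) (hv₀ : v ≠ 0) (h : ⁅y, v⁆ = ⁅z, v⁆) : y = z :=
  sub_eq_zero.mp <| eq_zero_of_central (F := F) (sub_mem hy hz)
    (fun x hx ↦ by rw [sub_lie, hyc x hx, hzc x hx, sub_zero]) hv hv₀
    (by rw [sub_lie, h, sub_self])

/-- If a central element of the even part acts as the identity on a nonzero submodule of the odd
part, then this submodule is irreducible. -/
lemma isAtom_of_lie_eq_self {z : L} (hz : z ∈ 𝓛 0) (hzc : ∀ x ∈ 𝓛 0, ⁅z, x⁆ = 0)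
    {U : LieSubmodule F (even 𝓛) L} (hU : U ≤ odd 𝓛) (hU₀ : U ≠ ⊥) (h : ∀ u ∈ U, ⁅z, u⁆ = u) :
    IsAtom U := by
  -- The central element attached to N agrees with z on N, so it is z; evaluating 2 tr_N at z gives
  -- the dimension.
  have key : ∀ N ≤ U, N ≠ ⊥ → killingForm F L z z = 2 * (finrank F N : F) := by
    intro N hN hN₀
    have hiso := isotropic_of_lie_eq_smul (one_ne_zero (α := F)) (z := z) (N := N)
      fun x hx ↦ by rw [h x (hN hx), one_smul]
    obtain ⟨z', hz', hzc', hz1, htr⟩ := exists_central_of_isotropic (hN.trans hU) hiso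
    obtain ⟨n, hn, hn₀⟩ := exists_mem_ne_zero hN₀
    obtain rfl := eq_of_central (F := F) hz hzc hz' hzc' (hU (hN hn)) hn₀
      ((h n (hN hn)).trans (hz1 n hn).symm)
    rw [htr ⟨z, hz⟩]
    have : LieModule.toEnd F (even 𝓛) N ⟨z, hz⟩ = 1 := by
      ext ⟨n, hn⟩
      exact hz1 n hn
    rw [this, LinearMap.trace_one]
  refine ⟨hU₀, fun N hN ↦ ?_⟩
  by_contra hN₀
  have hrank : finrank F N = finrank F U := by
    have := (key N hN.le hN₀).symm.trans (key U le_rfl hU₀)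
    exact_mod_cast mul_left_cancel₀ two_ne_zero this
  refine hN.ne ((LieSubmodule.toSubmodule_inj _ _).mp ?_)
  exact Submodule.eq_of_le_of_finrank_eq hN.le hrank

/-- If the odd part is reducible, then some central element of the even part squares to the
identity on the odd part. -/
lemma exists_central_sq_eq_one (hodd : 𝓛 1 ≠ ⊥)
    (h : ¬ LieModule.IsIrreducible F (even 𝓛) (odd 𝓛)) :
    ∃ z ∈ 𝓛 0, (∀ x ∈ 𝓛 0, ⁅z, x⁆ = 0) ∧ ∀ v ∈ 𝓛 1, ⁅z, ⁅z, v⁆⁆ = v := by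
  obtain ⟨N, hN, hN₀, hiso⟩ := exists_isotropic hodd h
  obtain ⟨n, hn, hn₀⟩ := exists_mem_ne_zero hN₀
  obtain ⟨z, hz, hzc, hz1, -⟩ := exists_central_of_isotropic hN hiso
  refine ⟨z, hz, hzc, fun v hv ↦ ?_⟩
  set f := ad F L z with hf
  have hfc : ∀ x ∈ 𝓛 0, Commute (ad F L x) f := fun x hx ↦ by
    ext w
    change ⁅x, ⁅z, w⁆⁆ = ⁅z, ⁅x, w⁆⁆
    rw [leibniz_lie z, hzc x hx, zero_lie, zero_add]
  have hf₀ : ∀ x ∈ 𝓛 0, f x ∈ 𝓛 0 := fun x hx ↦ lie_even_even hz hx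
  have hf₁ : ∀ x ∈ 𝓛 1, f x ∈ 𝓛 1 := fun x hx ↦ lie_even_odd hz hx
  have hfk : ∀ x y, killingForm F L (f x) y = - killingForm F L x (f y) := killingForm_lie z
  -- `A` and `B` are adjoint to each other since f = ad z is skew; thus A * B = 1 - f² is
  -- self-adjoint, and it kills N.
  set A : End F L := 1 + f with hA
  set B : End F L := 1 - f with hB
  have hAB : Commute A B := by
    rw [hA, hB]
    exact ((Commute.one_left _).add_left (Commute.sub_right (Commute.one_right _) (Commute.refl _)))
  have hAc : ∀ x ∈ 𝓛 0, Commute (ad F L x) A := fun x hx ↦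
    (Commute.one_right _).add_right (hfc x hx)
  have hBc : ∀ x ∈ 𝓛 0, Commute (ad F L x) B := fun x hx ↦
    (Commute.one_right _).sub_right (hfc x hx)
  have hA₁ : ∀ x ∈ 𝓛 1, A x ∈ 𝓛 1 := fun x hx ↦ add_mem hx (hf₁ x hx)
  have hB₁ : ∀ x ∈ 𝓛 1, B x ∈ 𝓛 1 := fun x hx ↦ sub_mem hx (hf₁ x hx)
  have hAk : ∀ x y, killingForm F L (A x) y = killingForm F L x (B y) := fun x y ↦ by
    simp [hA, hB, hfk, sub_eq_add_neg]
  have hApow : ∀ k, ∀ x ∈ 𝓛 1, (A ^ k) x ∈ 𝓛 1 := fun k ↦ by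
    induction k with
    | zero => simp
    | succ k ih => exact fun x hx ↦ by rw [pow_succ']; exact hA₁ _ (ih x hx)
  have hBpow : ∀ k, ∀ x ∈ 𝓛 1, (B ^ k) x ∈ 𝓛 1 := fun k ↦ by
    induction k with
    | zero => simp
    | succ k ih => exact fun x hx ↦ by rw [pow_succ']; exact hB₁ _ (ih x hx)
  have hAkpow : ∀ k x y, killingForm F L ((A ^ k) x) y = killingForm F L x ((B ^ k) y) := by
    intro k
    induction k with
    | zero => simp
    | succ k ih =>
      intro x y
      rw [pow_succ, End.mul_apply, ih, hAk, pow_succ', End.mul_apply]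
  have hAn : ∀ n ∈ N, A n = (2 : F) • n := fun n hn ↦ by
    rw [two_smul]
    exact congr_arg (n + ·) (hz1 n hn)
  obtain ⟨k, hk⟩ := exists_pow_eq_zero_of_apply_eq_zero (𝓛 := 𝓛) (T := A * B) (ε := 1) (v := n)
    (fun x hx ↦ add_mem (sub_mem hx (hf₀ x hx)) (hf₀ _ (sub_mem hx (hf₀ x hx))))
    (fun x hx ↦ hA₁ _ (hB₁ x hx))
    (fun x hx v ↦ (LinearMap.congr_fun ((hAc x hx).mul_right (hBc x hx)).eq v).symm)
    (fun x y ↦ by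
      rw [End.mul_apply, hAk, killingForm_comm, ← hAk, killingForm_comm, one_mul]
      rfl)
    (hN hn) hn₀ (by
      rw [hAB.eq, End.mul_apply, hAn n hn, map_smul]
      refine (congr_arg ((2 : F) • ·) ?_).trans (smul_zero _)
      exact sub_eq_zero.mpr (hz1 n hn).symm)
  rw [hAB.mul_pow] at hk
  -- This is the generalized 1-eigenspace of z. It is isotropic because B ^ k * A ^ k = 0 on 𝓛₁, and
  -- it contains n because A n = 2n.
  let V : LieSubmodule F (even 𝓛) L :=
    { __ := (𝓛 1).map (A ^ k)
      lie_mem := by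
        rintro ⟨x, hx⟩ _ ⟨u, hu, rfl⟩
        exact ⟨⁅x, u⁆, lie_even_odd hx hu,
          (LinearMap.congr_fun ((hAc x hx).pow_right k).eq u).symm⟩ }
  have hV : ∀ u ∈ 𝓛 1, (A ^ k) u ∈ V := fun u hu ↦ ⟨u, hu, rfl⟩
  have hVodd : V ≤ odd 𝓛 := by
    rintro _ ⟨u, hu, rfl⟩
    exact hApow k u hu
  have hViso : ∀ x ∈ V, ∀ y ∈ V, killingForm F L x y = 0 := by
    rintro _ ⟨u, hu, rfl⟩ _ ⟨w, hw, rfl⟩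
    rw [hAkpow, ← End.mul_apply, ← (hAB.pow_pow k k).eq, hk w hw, map_zero]
  have hnV : n ∈ V := by
    have : ∀ i, (A ^ i) n = ((2 : F) ^ i) • n := fun i ↦ by
      induction i with
      | zero => simp
      | succ i ih => rw [pow_succ', End.mul_apply, ih, map_smul, hAn n hn, smul_smul, pow_succ]
    have h2 := hV n (hN hn)
    rw [this] at h2
    exact (Submodule.smul_mem_iff V.toSubmodule (pow_ne_zero k two_ne_zero)).mp h2
  obtain ⟨z', hz', hzc', hz1', -⟩ := exists_central_of_isotropic hVodd hViso
  obtain rfl := eq_of_central (F := F) hz hzc hz' hzc' (hN hn) hn₀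
    ((hz1 n hn).trans (hz1' n hnV).symm)
  have h1 : ∀ v ∈ 𝓛 1, (B * A ^ k) v = 0 := fun v hv ↦ sub_eq_zero.mpr (hz1' _ (hV v hv)).symm
  -- This is the adjoint of `h1`.
  have h2 : ∀ v ∈ 𝓛 1, (B ^ k * A) v = 0 := fun v hv ↦ by
    refine eq_zero_of_odd (F := F) (𝓛 := 𝓛) (hBpow k _ (hA₁ v hv)) fun w hw ↦ ?_
    rw [killingForm_comm, End.mul_apply, ← hAkpow, killingForm_comm, hAk, ← End.mul_apply, h1 w hw,
      map_zero]
  -- Since A ^ k and B ^ k are coprime polynomials in f, `h1` and `h2` together give A * B = 0 on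
  -- 𝓛₁.
  open Polynomial in
  have hcop : IsCoprime ((1 + X : F[X]) ^ k) ((1 - X) ^ k) := by
    refine IsCoprime.pow ⟨C 2⁻¹, C 2⁻¹, ?_⟩
    rw [← mul_add, add_add_sub_cancel, one_add_one_eq_two, ← C_ofNat, ← C_mul,
      inv_mul_cancel₀ two_ne_zero, C_1]
  obtain ⟨a, b, hab⟩ := hcop
  open Polynomial in
  have hpol : (1 + X : F[X]) * (1 - X) = a * (1 + X) * ((1 - X) * (1 + X) ^ k) +
      b * (1 - X) * ((1 - X) ^ k * (1 + X)) := by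
    linear_combination (-(1 + X) * (1 - X)) * hab
  have := LinearMap.congr_fun (congr_arg (Polynomial.aeval f) hpol) v
  simp only [map_mul, map_add, map_sub, map_one, Polynomial.aeval_X, map_pow, ← hA, ← hB,
    LinearMap.add_apply] at this
  rw [End.mul_apply (_ * _) (B * A ^ k), End.mul_apply (_ * _) (B ^ k * A), h1 v hv, h2 v hv,
    map_zero, map_zero, add_zero] at this
  have h3 : A * B = 1 - f * f := by rw [hA, hB]; noncomm_ring
  rw [h3] at this
  exact (sub_eq_zero.mp this).symm

/-- If the odd part is reducible, then it is the direct sum of two irreducible submodules, on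
which a central element of the even part acts as `1` and as `-1`. -/
theorem exists_splitting (hodd : 𝓛 1 ≠ ⊥) (h : ¬ LieModule.IsIrreducible F (even 𝓛) (odd 𝓛)) :
    ∃ z ∈ 𝓛 0, ∃ V W : LieSubmodule F (even 𝓛) L, (∀ x ∈ 𝓛 0, ⁅z, x⁆ = 0) ∧
      IsAtom V ∧ IsAtom W ∧ V ⊓ W = ⊥ ∧ V ⊔ W = odd 𝓛 ∧
      (∀ v ∈ V, ⁅z, v⁆ = v) ∧ (∀ w ∈ W, ⁅z, w⁆ = - w) := by
  obtain ⟨z, hz, hzc, hsq⟩ := exists_central_sq_eq_one hodd h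
  set V := oddEigenspace (F := F) 𝓛 hzc 1
  set W := oddEigenspace (F := F) 𝓛 hzc (-1)
  have hVodd : V ≤ odd 𝓛 := fun v hv ↦ hv.1
  have hWodd : W ≤ odd 𝓛 := fun v hv ↦ hv.1
  have hV : ∀ v ∈ V, ⁅z, v⁆ = v := fun v hv ↦ by rw [(mem_oddEigenspace.mp hv).2, one_smul]
  have hW : ∀ v ∈ W, ⁅z, v⁆ = - v := fun v hv ↦ by rw [(mem_oddEigenspace.mp hv).2, neg_one_smul]
  have hsup : V ⊔ W = odd 𝓛 := by
    refine le_antisymm (sup_le hVodd hWodd) fun v hv ↦ ?_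
    have hv' : (2 : F)⁻¹ • (v + ⁅z, v⁆) + (2 : F)⁻¹ • (v - ⁅z, v⁆) = v := by
      rw [← smul_add, add_add_sub_cancel, ← two_smul F, smul_smul, inv_mul_cancel₀ two_ne_zero,
        one_smul]
    rw [← hv']
    refine add_mem (LieSubmodule.mem_sup_left (SMulMemClass.smul_mem _ ?_))
      (LieSubmodule.mem_sup_right (SMulMemClass.smul_mem _ ?_))
    · refine mem_oddEigenspace.mpr ⟨add_mem hv (lie_even_odd hz hv), ?_⟩
      rw [lie_add, hsq v hv, one_smul, add_comm]
    · refine mem_oddEigenspace.mpr ⟨sub_mem hv (lie_even_odd hz hv), ?_⟩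
      rw [lie_sub, hsq v hv, neg_one_smul, neg_sub]
  -- Otherwise 𝓛₁ = W would be totally isotropic, against nondegeneracy.
  have hV₀ : V ≠ ⊥ := fun h ↦ by
    rw [h, bot_sup_eq] at hsup
    exact ne_odd_of_isotropic hodd (isotropic_of_lie_eq_smul (neg_ne_zero.mpr one_ne_zero)
      fun x hx ↦ (mem_oddEigenspace.mp hx).2) hsup
  have hW₀ : W ≠ ⊥ := fun h ↦ by
    rw [h, sup_bot_eq] at hsup
    exact ne_odd_of_isotropic hodd (isotropic_of_lie_eq_smul one_ne_zero
      fun x hx ↦ (mem_oddEigenspace.mp hx).2) hsup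
  refine ⟨z, hz, V, W, hzc, isAtom_of_lie_eq_self hz hzc hVodd hV₀ hV,
    isAtom_of_lie_eq_self (neg_mem hz) (fun x hx ↦ by rw [neg_lie, hzc x hx, neg_zero]) hWodd hW₀
      fun w hw ↦ by rw [neg_lie, hW w hw, neg_neg], ?_, hsup, hV, hW⟩
  refine eq_bot_of_forall fun u hu ↦ ?_
  have := (hV u hu.1).symm.trans (hW u hu.2)
  rw [eq_neg_iff_add_eq_zero, ← two_smul F] at this
  exact (smul_eq_zero.mp this).resolve_left two_ne_zero

end Splitting

/-! ### Spaces of invariant forms and lattices of submodules -/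

lemma finrank_submodule_eq_one {F E : Type*} [Field F] [AddCommGroup E] [Module F E]
    {S : Submodule F E} {v : E} (hv : v ∈ S) (hv₀ : v ≠ 0) (h : ∀ w ∈ S, ∃ c : F, c • v = w) :
    finrank F S = 1 := by
  refine (finrank_eq_one_iff_of_nonzero' (⟨v, hv⟩ : S) fun h ↦ hv₀ (congr_arg Subtype.val h)).mpr ?_
  rintro ⟨w, hw⟩
  obtain ⟨c, hc⟩ := h w hw
  exact ⟨c, Subtype.ext hc⟩

lemma exists_apply_eq_smul_apply {F M : Type*} [Field F] [IsAlgClosed F] [AddCommGroup M]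
    [Module F M] [FiniteDimensional F M] [Nontrivial M] {κ : LinearMap.BilinForm F M}
    (hκ : κ.Nondegenerate) (B : LinearMap.BilinForm F M) :
    ∃ c : F, ∃ u : M, u ≠ 0 ∧ B u = c • κ u := by
  -- An eigenvector of κ⁻¹B is a kernel vector of B - cκ.
  let T : End F M := (κ.toDual hκ).symm.toLinearMap ∘ₗ B
  obtain ⟨c, hc⟩ := End.exists_eigenvalue T
  obtain ⟨u, hu⟩ := hc.exists_hasEigenvector
  refine ⟨c, u, hu.2, LinearMap.ext fun v ↦ ?_⟩
  have h1 : κ (T u) v = B u v := LinearMap.BilinForm.apply_toDual_symm_apply (hB := hκ) (B u) v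
  rw [← h1, hu.apply_eq_smul, map_smul]

lemma finrank_symmInvariantForms_eq_one {F g M : Type*} [Field F] [IsAlgClosed F] [LieRing g]
    [LieAlgebra F g] [AddCommGroup M] [Module F M] [LieRingModule g M] [LieModule F g M]
    [FiniteDimensional F M] [Nontrivial M] {κ : LinearMap.BilinForm F M}
    (hκ : κ ∈ symmInvariantForms F g M) (hκ₀ : ∀ u, κ u = 0 → u = 0)
    (h : ∀ B ∈ symmInvariantForms F g M, ∀ u, u ≠ 0 → B u = 0 → B = 0) :
    finrank F (symmInvariantForms F g M) = 1 := by
  have hκnd : κ.Nondegenerate :=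
    hκ.1.isRefl.nondegenerate_iff_separatingLeft.mpr fun u hu ↦ hκ₀ u (LinearMap.ext hu)
  obtain ⟨u₀, hu₀⟩ := exists_ne (0 : M)
  have hne : κ ≠ 0 := fun h ↦ hu₀ (hκ₀ u₀ (by rw [h, LinearMap.zero_apply]))
  have key : ∀ B ∈ symmInvariantForms F g M, ∃ c : F, c • κ = B := fun B hB ↦ by
    obtain ⟨c, u, hu, hBu⟩ := exists_apply_eq_smul_apply hκnd B
    have hmem : B + (-c) • κ ∈ symmInvariantForms F g M :=
      add_mem hB (Submodule.smul_mem _ (-c) hκ)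
    have h0 := h _ hmem u hu (by
      rw [LinearMap.add_apply, LinearMap.smul_apply, hBu, neg_smul, add_neg_cancel])
    refine ⟨c, LinearMap.ext₂ fun v w ↦ ?_⟩
    have hvw := LinearMap.congr_fun₂ h0 v w
    rw [LinearMap.add_apply, LinearMap.add_apply, LinearMap.smul_apply, LinearMap.smul_apply,
      neg_smul, LinearMap.zero_apply, LinearMap.zero_apply, add_neg_eq_zero] at hvw
    exact hvw.symm
  exact finrank_submodule_eq_one (E := LinearMap.BilinForm F M) hκ hne key

lemma isAtom_comap_incl {R g M : Type*} [CommRing R] [LieRing g] [LieAlgebra R g] [AddCommGroup M]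
    [Module R M] [LieRingModule g M] [LieModule R g M] {N V : LieSubmodule R g M} (hVN : V ≤ N)
    (hV : IsAtom V) : IsAtom (V.comap N.incl) := by
  refine ⟨fun h ↦ hV.1 ?_, fun U hU ↦ ?_⟩
  · rwa [LieSubmodule.comap_incl_eq_bot, inf_eq_right.mpr hVN] at h
  · have hinj := LieSubmodule.map_injective_of_injective N.injective_incl
    rcases hV.le_iff.mp (LieSubmodule.map_le_iff_le_comap.mpr hU.le) with h | h
    · exact hinj (h.trans LieSubmodule.map_bot.symm)
    · refine absurd (hinj ?_) hU.ne
      rw [h, LieSubmodule.map_comap_incl, inf_eq_right.mpr hVN]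

lemma complementedLattice_of_sup_atoms {R g M : Type*} [CommRing R] [LieRing g] [LieAlgebra R g]
    [AddCommGroup M] [Module R M] [LieRingModule g M] [LieModule R g M]
    {N V W : LieSubmodule R g M} (hV : IsAtom V) (hW : IsAtom W) (hsup : V ⊔ W = N) :
    ComplementedLattice (LieSubmodule R g N) := by
  have hVN : V ≤ N := hsup ▸ le_sup_left
  have hWN : W ≤ N := hsup ▸ le_sup_right
  refine complementedLattice_of_sSup_atoms_eq_top (eq_top_iff.mpr ?_)
  refine le_trans (b := V.comap N.incl ⊔ W.comap N.incl) (le_of_eq ?_)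
    (sup_le (le_sSup (isAtom_comap_incl hVN hV)) (le_sSup (isAtom_comap_incl hWN hW)))
  refine LieSubmodule.map_injective_of_injective N.injective_incl ?_
  rw [LieSubmodule.map_incl_top, LieSubmodule.map_sup, LieSubmodule.map_comap_incl,
    LieSubmodule.map_comap_incl, inf_eq_right.mpr hVN, inf_eq_right.mpr hWN, hsup]

/-! ### The three-term integer grading -/

section Grading

variable {F L : Type*} [Field F] [LieRing L] [LieAlgebra F L]
  {𝓛 : ZMod 2 → Submodule F L} [GradedLieAlgebra 𝓛]

/-- The eigenspaces of an inner derivation form a `ℤ`-grading as soon as they span. -/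
lemma nonempty_gradedLieAlgebra_eigenspace [CharZero F] (z : L)
    (h : ⨆ n : ℤ, End.eigenspace (ad F L z) (n : F) = ⊤) :
    Nonempty (GradedLieAlgebra fun n : ℤ ↦ End.eigenspace (ad F L z) (n : F)) := by
  have hint : DirectSum.IsInternal fun n : ℤ ↦ End.eigenspace (ad F L z) (n : F) :=
    DirectSum.isInternal_submodule_of_iSupIndep_of_iSup_eq_top
      ((End.eigenspaces_iSupIndep (ad F L z)).comp Int.cast_injective) h
  refine ⟨{ hint.chooseDecomposition with bracket_mem := fun i j x y hx hy ↦ ?_ }⟩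
  rw [End.mem_eigenspace_iff, ad_apply] at hx hy ⊢
  rw [leibniz_lie, hx, hy, smul_lie, lie_smul, ← add_smul, Int.cast_add]

variable {V W : LieSubmodule F (even 𝓛) L} {z : L} (hzc : ∀ x ∈ 𝓛 0, ⁅z, x⁆ = 0)
  (hinf : V ⊓ W = ⊥) (hsup : V ⊔ W = odd 𝓛) (hV : ∀ v ∈ V, ⁅z, v⁆ = v)
  (hW : ∀ w ∈ W, ⁅z, w⁆ = -w)
include hzc hinf hsup hV hW

/-- Each component of an eigenvector of ad z satisfies the eigenvalue equation separately, so at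
most one survives. -/
lemma exists_of_lie_eq_smul {c : F} {x : L} (hx : ⁅z, x⁆ = c • x) :
    ∃ a ∈ 𝓛 0, ∃ v ∈ V, ∃ w ∈ W, a + (v + w) = x ∧ c • a = 0 ∧ (c - 1) • v = 0 ∧
      (c + 1) • w = 0 := by
  obtain ⟨a, ha, b, hb, rfl⟩ := exists_even_add_odd (𝓛 := 𝓛) x
  have hb' := hb
  rw [← mem_odd, ← hsup] at hb'
  obtain ⟨v, hv, w, hw, rfl⟩ := (LieSubmodule.mem_sup _ _ _).mp hb'
  have hv₁ : v ∈ 𝓛 1 := (hsup ▸ le_sup_left : V ≤ odd 𝓛) hv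
  have hw₁ : w ∈ 𝓛 1 := (hsup ▸ le_sup_right : W ≤ odd 𝓛) hw
  rw [lie_add, lie_add, hzc a ha, hV v hv, hW w hw, zero_add] at hx
  have h0 : c • a = 0 := by
    refine eq_zero_of_even_of_odd (𝓛 := 𝓛) (Submodule.smul_mem _ _ ha) ?_
    have : c • a = v - w - c • (v + w) := by
      rw [sub_eq_add_neg v, hx, smul_add, add_sub_cancel_right]
    rw [this]
    exact sub_mem (sub_mem hv₁ hw₁) (Submodule.smul_mem _ _ hb)
  have h1 : (c - 1) • v = - ((c + 1) • w) := by
    rw [smul_add, h0, zero_add, smul_add] at hx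
    rw [sub_smul, add_smul, one_smul, one_smul, ← sub_eq_zero]
    rw [← sub_eq_zero] at hx
    rw [← neg_eq_zero, ← hx]
    abel
  have h2 : (c - 1) • v = 0 := by
    have : (c - 1) • v ∈ V ⊓ W :=
      ⟨SMulMemClass.smul_mem _ hv, h1 ▸ neg_mem (SMulMemClass.smul_mem _ hw)⟩
    rwa [hinf, LieSubmodule.mem_bot] at this
  exact ⟨a, ha, v, hv, w, hw, rfl, h0, h2, by rwa [h2, eq_comm, neg_eq_zero] at h1⟩

/-- A splitting of the odd part gives rise to a `ℤ`-grading with three components. -/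
lemma exists_int_grading [CharZero F] :
    ∃ 𝒢 : ℤ → Submodule F L, Nonempty (GradedLieAlgebra 𝒢) ∧
      𝒢 (-1) = W.toSubmodule ∧ 𝒢 0 = 𝓛 0 ∧ 𝒢 1 = V.toSubmodule ∧
      ∀ n : ℤ, n ≠ -1 → n ≠ 0 → n ≠ 1 → 𝒢 n = ⊥ := by
  let 𝒢 : ℤ → Submodule F L := fun n ↦ End.eigenspace (ad F L z) (n : F)
  have hmem : ∀ n x, x ∈ 𝒢 n ↔ ⁅z, x⁆ = (n : F) • x := fun n x ↦ End.mem_eigenspace_iff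
  have h0 : 𝓛 0 ≤ 𝒢 0 := fun x hx ↦ by rw [hmem, hzc x hx, Int.cast_zero, zero_smul]
  have h1 : V.toSubmodule ≤ 𝒢 1 := fun x hx ↦ by rw [hmem, hV x hx, Int.cast_one, one_smul]
  have h2 : W.toSubmodule ≤ 𝒢 (-1) := fun x hx ↦ by
    rw [hmem, hW x hx, Int.cast_neg, Int.cast_one, neg_one_smul]
  have hdec := fun (n : ℤ) (x : L) (hx : x ∈ 𝒢 n) ↦
    exists_of_lie_eq_smul hzc hinf hsup hV hW ((hmem n x).mp hx)
  have ha₀ : ∀ {n : ℤ} {a : L}, n ≠ 0 → (n : F) • a = 0 → a = 0 := fun hn h ↦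
    (smul_eq_zero.mp h).resolve_left (Int.cast_ne_zero.mpr hn)
  have hv₀ : ∀ {n : ℤ} {v : L}, n ≠ 1 → ((n : F) - 1) • v = 0 → v = 0 := fun hn h ↦
    ha₀ (sub_ne_zero.mpr hn) (by rwa [Int.cast_sub, Int.cast_one])
  have hw₀ : ∀ {n : ℤ} {w : L}, n ≠ -1 → ((n : F) + 1) • w = 0 → w = 0 := fun hn h ↦
    ha₀ (fun h ↦ hn (eq_neg_of_add_eq_zero_left h)) (by rwa [Int.cast_add, Int.cast_one])
  refine ⟨𝒢, nonempty_gradedLieAlgebra_eigenspace z (eq_top_iff.mpr fun x _ ↦ ?_),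
    le_antisymm (fun x hx ↦ ?_) h2, le_antisymm (fun x hx ↦ ?_) h0,
    le_antisymm (fun x hx ↦ ?_) h1, fun n hn1 hn0 hn2 ↦ (Submodule.eq_bot_iff _).mpr fun x hx ↦ ?_⟩
  · obtain ⟨a, ha, b, hb, rfl⟩ := exists_even_add_odd (𝓛 := 𝓛) x
    rw [← mem_odd, ← hsup] at hb
    obtain ⟨v, hv, w, hw, rfl⟩ := (LieSubmodule.mem_sup _ _ _).mp hb
    have hle := le_iSup 𝒢
    exact add_mem (hle 0 (h0 ha)) (add_mem (hle 1 (h1 hv)) (hle (-1) (h2 hw)))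
  · obtain ⟨a, -, v, -, w, hw, rfl, ha, hv, -⟩ := hdec _ x hx
    rwa [ha₀ (by decide) ha, hv₀ (by decide) hv, zero_add, zero_add]
  · obtain ⟨a, haL, v, -, w, -, rfl, -, hv, hw⟩ := hdec _ x hx
    rwa [hv₀ (by decide) hv, hw₀ (by decide) hw, add_zero, add_zero]
  · obtain ⟨a, -, v, hvV, w, -, rfl, ha, -, hw⟩ := hdec _ x hx
    rwa [ha₀ (by decide) ha, hw₀ (by decide) hw, zero_add, add_zero]
  · obtain ⟨a, -, v, -, w, -, rfl, ha, hv, hw⟩ := hdec _ x hx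
    rw [ha₀ hn0 ha, hv₀ hn2 hv, hw₀ hn1 hw, add_zero, add_zero]

end Grading

/-! ### The even part acting on the odd part -/

section Module

variable {F L : Type*} [Field F] [LieRing L] [LieAlgebra F L]
  {𝓛 : ZMod 2 → Submodule F L} [GradedLieAlgebra 𝓛]

lemma mem_center_iff {z : even 𝓛} :
    z ∈ LieAlgebra.center F (even 𝓛) ↔ ∀ x ∈ 𝓛 0, ⁅(z : L), x⁆ = 0 := by
  refine (LieModule.mem_maxTrivSubmodule F (even 𝓛) (even 𝓛) z).trans
    ⟨fun h x hx ↦ ?_, fun h x ↦ ?_⟩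
  · rw [← lie_skew, neg_eq_zero]
    exact congr_arg Subtype.val (h ⟨x, hx⟩)
  · refine Subtype.ext ?_
    change ⁅(x : L), (z : L)⁆ = 0
    rw [← lie_skew, h x x.2, neg_zero]

lemma isFaithful_odd [LieAlgebra.IsSimple F L] (hodd : 𝓛 1 ≠ ⊥) : LieModule.IsFaithful F (even 𝓛) (odd 𝓛) := by
  refine ⟨(injective_iff_map_eq_zero _).mpr fun x hx ↦ Subtype.ext ?_⟩
  exact eq_zero_of_lie_odd_eq_zero (F := F) hodd x.2 fun v hv ↦
    congr_arg Subtype.val (LinearMap.congr_fun hx ⟨v, hv⟩)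

lemma exists_lie_eq_smul [IsAlgClosed F] [FiniteDimensional F L] {U : LieSubmodule F (even 𝓛) L} (hU : U ≠ ⊥) {y : L} (hy : y ∈ 𝓛 0) :
    ∃ c : F, ∃ u ∈ U, u ≠ 0 ∧ ⁅y, u⁆ = c • u := by
  have : Nontrivial U := (LieSubmodule.nontrivial_iff_ne_bot F (even 𝓛) L).mpr hU
  obtain ⟨c, hc⟩ := End.exists_eigenvalue (LieModule.toEnd F (even 𝓛) U ⟨y, hy⟩)
  obtain ⟨⟨u, hu⟩, huc⟩ := hc.exists_hasEigenvector
  exact ⟨c, u, hu, fun h ↦ huc.2 (Subtype.ext h), congr_arg Subtype.val huc.apply_eq_smul⟩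

variable (𝓛) in
/-- The Killing form of a graded Lie algebra, restricted to the odd part. -/
noncomputable def oddKillingForm : LinearMap.BilinForm F (odd 𝓛) :=
  (killingForm F L).compl₁₂ ((odd 𝓛).incl : odd 𝓛 →ₗ[F] L) ((odd 𝓛).incl : odd 𝓛 →ₗ[F] L)

variable (𝓛) in
lemma oddKillingForm_mem :
    oddKillingForm 𝓛 ∈ symmInvariantForms F (even 𝓛) (odd 𝓛) :=
  ⟨⟨fun u v ↦ killingForm_comm (F := F) (u : L) v⟩,
    fun x u v ↦ killingForm_lie (F := F) (x : L) u v⟩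

end Module

/-! ### Faithfulness of V, the center, and invariant forms -/

section Main

variable {F L : Type*} [Field F] [CharZero F] [LieRing L] [LieAlgebra F L] [FiniteDimensional F L]
  [LieAlgebra.IsSimple F L] {𝓛 : ZMod 2 → Submodule F L} [GradedLieAlgebra 𝓛]

/-- W is isotropic, so κ pairs it with V only: if x kills V, then κ([x, w], v) = -κ(w, [x, v]) = 0,
and x kills W too. -/
lemma isFaithful_of_splitting (hodd : 𝓛 1 ≠ ⊥) {V W : LieSubmodule F (even 𝓛) L} {z : L}
    (hsup : V ⊔ W = odd 𝓛) (hW : ∀ w ∈ W, ⁅z, w⁆ = -w) :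
    LieModule.IsFaithful F (even 𝓛) V := by
  refine ⟨(injective_iff_map_eq_zero _).mpr fun x hx ↦ Subtype.ext ?_⟩
  have hWodd : W ≤ odd 𝓛 := hsup ▸ le_sup_right
  have hdec : ∀ u ∈ 𝓛 1, ∃ v ∈ V, ∃ w ∈ W, v + w = u := fun u hu ↦ by
    rw [← mem_odd, ← hsup] at hu
    exact (LieSubmodule.mem_sup _ _ _).mp hu
  have hxV : ∀ v ∈ V, ⁅(x : L), v⁆ = 0 := fun v hv ↦
    congr_arg Subtype.val (LinearMap.congr_fun hx ⟨v, hv⟩)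
  have hiso := isotropic_of_lie_eq_smul (F := F) (z := z) (N := W) (neg_ne_zero.mpr one_ne_zero)
    fun w hw ↦ by rw [hW w hw, neg_one_smul]
  refine eq_zero_of_lie_odd_eq_zero (F := F) hodd x.2 fun u hu ↦ ?_
  obtain ⟨v, hv, w, hw, rfl⟩ := hdec u hu
  rw [lie_add, hxV v hv, zero_add]
  refine eq_zero_of_odd (F := F) (lie_even_odd x.2 (hWodd hw)) fun y hy ↦ ?_
  obtain ⟨v', hv', w', hw', rfl⟩ := hdec y hy
  rw [map_add, hiso _ (lie_mem_of_even W x.2 hw) _ hw', add_zero, killingForm_lie, hxV v' hv',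
    map_zero, neg_zero]

/-- A degenerate symmetric invariant bilinear form on the odd part vanishes. -/
lemma eq_zero_of_mem_symmInvariantForms (hodd : 𝓛 1 ≠ ⊥) {B : LinearMap.BilinForm F (odd 𝓛)}
    (hB : B ∈ symmInvariantForms F (even 𝓛) (odd 𝓛)) {u : odd 𝓛} (hu : u ≠ 0) (hBu : B u = 0) :
    B = 0 := by
  obtain ⟨hsymm, hinv⟩ := hB
  let K : LieSubmodule F (even 𝓛) (odd 𝓛) :=
    { __ := LinearMap.ker B
      lie_mem := by
        intro x m hm
        refine LinearMap.mem_ker.mpr (LinearMap.ext fun v ↦ ?_)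
        rw [hinv, LinearMap.mem_ker.mp hm, LinearMap.zero_apply, LinearMap.zero_apply, neg_zero] }
  have hK : ∀ v, v ∈ K ↔ B v = 0 := fun v ↦ Iff.rfl
  by_cases hirr : LieModule.IsIrreducible F (even 𝓛) (odd 𝓛)
  · rcases hirr.eq_bot_or_eq_top K with h | h
    · exact absurd ((LieSubmodule.eq_bot_iff K).mp h u hBu) hu
    · exact LinearMap.ext fun v ↦ (hK v).mp (h ▸ LieSubmodule.mem_top v)
  · obtain ⟨z, hz, V, W, hzc, hVatom, hWatom, -, hsup, hV, hW⟩ := exists_splitting hodd hirr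
    have hVodd : V ≤ odd 𝓛 := hsup ▸ le_sup_left
    have hWodd : W ≤ odd 𝓛 := hsup ▸ le_sup_right
    have hdec : ∀ x : odd 𝓛, ∃ v, ∃ hv : v ∈ V, ∃ w, ∃ hw : w ∈ W,
        x = ⟨v, hVodd hv⟩ + ⟨w, hWodd hw⟩ := fun x ↦ by
      obtain ⟨v, hv, w, hw, h⟩ := (LieSubmodule.mem_sup _ _ _).mp
        (show (x : L) ∈ V ⊔ W by rw [hsup]; exact x.2)
      exact ⟨v, hv, w, hw, Subtype.ext h.symm⟩
    have hiso : ∀ {U : LieSubmodule F (even 𝓛) L} (hUodd : U ≤ odd 𝓛) {c : F}, c ≠ 0 →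
        (∀ x ∈ U, ⁅z, x⁆ = c • x) → ∀ x (hx : x ∈ U) y (hy : y ∈ U),
          B ⟨x, hUodd hx⟩ ⟨y, hUodd hy⟩ = 0 := by
      intro U hUodd c hc hU x hx y hy
      have hz' : ∀ x (hx : x ∈ U), ⁅(⟨z, hz⟩ : even 𝓛), (⟨x, hUodd hx⟩ : odd 𝓛)⁆ =
        c • ⟨x, hUodd hx⟩ := fun x hx ↦ Subtype.ext (hU x hx)
      have := hinv ⟨z, hz⟩ ⟨x, hUodd hx⟩ ⟨y, hUodd hy⟩
      rw [hz' x hx, hz' y hy, map_smul, map_smul, LinearMap.smul_apply, eq_neg_iff_add_eq_zero,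
        ← two_smul F, smul_smul, smul_eq_mul] at this
      exact (mul_eq_zero.mp this).resolve_left (mul_ne_zero two_ne_zero hc)
    have hVV := hiso hVodd one_ne_zero fun x hx ↦ by rw [hV x hx, one_smul]
    have hWW := hiso hWodd (neg_ne_zero.mpr one_ne_zero) fun x hx ↦ by rw [hW x hx, neg_one_smul]
    have hle : ∀ {U : LieSubmodule F (even 𝓛) L} (hUodd : U ≤ odd 𝓛), IsAtom U →
        ∀ x (hx : x ∈ U), x ≠ 0 → B ⟨x, hUodd hx⟩ = 0 → ∀ y (hy : y ∈ U),
          B ⟨y, hUodd hy⟩ = 0 := by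
      intro U hUodd hU x hx hx₀ hBx y hy
      have hatom := isAtom_comap_incl hUodd hU
      have h : U.comap (odd 𝓛).incl ≤ K := by
        refine (hatom.le_iff.mp (inf_le_left (b := K))).elim (fun h ↦ absurd ?_ hx₀)
          (fun h ↦ inf_eq_left.mp h)
        exact congr_arg Subtype.val
          ((LieSubmodule.eq_bot_iff _).mp h ⟨x, hUodd hx⟩ ⟨hx, hBx⟩)
      exact h (x := ⟨y, hUodd hy⟩) hy
    -- V and W are isotropic for B, so both components of the kernel vector u lie in the kernel. One
    -- is nonzero, and irreducibility puts V or W in the kernel.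
    have hVW : ∀ v (hv : v ∈ V) w (hw : w ∈ W), B ⟨v, hVodd hv⟩ ⟨w, hWodd hw⟩ = 0 := by
      obtain ⟨v, hv, w, hw, rfl⟩ := hdec u
      have hsum : B ⟨v, hVodd hv⟩ + B ⟨w, hWodd hw⟩ = 0 := by rw [← map_add, hBu]
      have hBv : B ⟨v, hVodd hv⟩ = 0 := by
        ext x
        obtain ⟨v', hv', w', hw', rfl⟩ := hdec x
        have := LinearMap.congr_fun hsum ⟨w', hWodd hw'⟩
        rw [LinearMap.add_apply, hWW w hw w' hw', add_zero] at this
        rw [map_add, hVV v hv v' hv', this, zero_add, LinearMap.zero_apply, LinearMap.zero_apply]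
      have hBw : B ⟨w, hWodd hw⟩ = 0 := by rwa [hBv, zero_add] at hsum
      intro v' hv' w' hw'
      by_cases hv₀ : v = 0
      · have hw₀ : w ≠ 0 := by
          rintro rfl
          exact hu (Subtype.ext (by simp [hv₀]))
        rw [hsymm.eq, hle hWodd hWatom w hw hw₀ hBw w' hw', LinearMap.zero_apply]
      · rw [hle hVodd hVatom v hv hv₀ hBv v' hv', LinearMap.zero_apply]
    ext x y
    obtain ⟨v, hv, w, hw, rfl⟩ := hdec x
    obtain ⟨v', hv', w', hw', rfl⟩ := hdec y
    have hWV : B ⟨w, hWodd hw⟩ ⟨v', hVodd hv'⟩ = 0 := by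
      rw [hsymm.eq, hVW v' hv' w hw]
    rw [map_add, map_add, LinearMap.add_apply, LinearMap.add_apply, hVV v hv v' hv',
      hVW v hv w' hw', hWV, hWW w hw w' hw', add_zero, add_zero, LinearMap.zero_apply,
      LinearMap.zero_apply]

variable [IsAlgClosed F]

/-- A central element acts on 𝓛₁ by a scalar, by Schur's argument; a nonzero scalar would make 𝓛₁
isotropic. -/
lemma center_eq_bot_of_isIrreducible (hodd : 𝓛 1 ≠ ⊥)
    (h : LieModule.IsIrreducible F (even 𝓛) (odd 𝓛)) : LieAlgebra.center F (even 𝓛) = ⊥ := by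
  rw [isIrreducible_iff_isAtom] at h
  refine eq_bot_of_forall fun y hy ↦ Subtype.ext ?_
  have hyc := mem_center_iff.mp hy
  obtain ⟨c, u, hu, hu₀, huc⟩ := exists_lie_eq_smul h.1 y.2
  have hle : oddEigenspace 𝓛 hyc c ≤ odd 𝓛 := fun v hv ↦ hv.1
  have hmem : u ∈ oddEigenspace 𝓛 hyc c := mem_oddEigenspace.mpr ⟨hu, huc⟩
  have htop : oddEigenspace 𝓛 hyc c = odd 𝓛 := (h.le_iff.mp hle).resolve_left fun h ↦
    hu₀ ((LieSubmodule.eq_bot_iff _).mp h u hmem)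
  have hc : c = 0 := by
    by_contra hc
    exact ne_odd_of_isotropic hodd
      (isotropic_of_lie_eq_smul hc fun x hx ↦ (mem_oddEigenspace.mp hx).2) htop
  exact eq_zero_of_central (F := F) y.2 hyc hu hu₀ (by rw [huc, hc, zero_smul])

/-- A central y has an eigenvector in V with some eigenvalue c, so it agrees with c • z there, hence
everywhere. -/
lemma center_eq_span {z : L} (hz : z ∈ 𝓛 0) (hzc : ∀ x ∈ 𝓛 0, ⁅z, x⁆ = 0)
    {V : LieSubmodule F (even 𝓛) L} (hVodd : V ≤ odd 𝓛) (hV₀ : V ≠ ⊥)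
    (hV : ∀ v ∈ V, ⁅z, v⁆ = v) :
    (LieAlgebra.center F (even 𝓛)).toSubmodule = Submodule.span F {(⟨z, hz⟩ : even 𝓛)} := by
  refine le_antisymm (fun y hy ↦ ?_) ((Submodule.span_singleton_le_iff_mem _ _).mpr ?_)
  · obtain ⟨c, v, hv, hv₀, hvc⟩ := exists_lie_eq_smul hV₀ y.2
    refine Submodule.mem_span_singleton.mpr ⟨c, Subtype.ext ?_⟩
    refine (eq_of_central (F := F) y.2 (mem_center_iff.mp hy) (Submodule.smul_mem _ c hz)
      (fun x hx ↦ by rw [smul_lie, hzc x hx, smul_zero]) (hVodd hv) hv₀ ?_).symm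
    rw [hvc, smul_lie, hV v hv]
  · exact mem_center_iff.mpr hzc

theorem finrank_symmInvariantForms (hodd : 𝓛 1 ≠ ⊥) :
    finrank F (symmInvariantForms F (even 𝓛) (odd 𝓛)) = 1 := by
  have : Nontrivial (odd 𝓛) :=
    (LieSubmodule.nontrivial_iff_ne_bot F (even 𝓛) L).mpr (odd_ne_bot hodd)
  refine finrank_symmInvariantForms_eq_one (oddKillingForm_mem 𝓛) (fun u hu ↦ Subtype.ext ?_)
    fun B hB u hu hBu ↦ eq_zero_of_mem_symmInvariantForms hodd hB hu hBu
  exact eq_zero_of_odd (F := F) u.2 fun y hy ↦ LinearMap.congr_fun hu ⟨y, hy⟩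

end Main

end GradedLie

end

theorem mainTheorem6 {F L : Type*} [Field F] [IsAlgClosed F] [CharZero F]
    [LieRing L] [LieAlgebra F L] [FiniteDimensional F L] [LieAlgebra.IsSimple F L]
    (𝓛 : ZMod 2 → Submodule F L) [GradedLieAlgebra 𝓛] (hodd : 𝓛 1 ≠ ⊥) :
    -- (1) `𝓛₀` is reductive, and acts faithfully and completely reducibly on `𝓛₁`,
    -- which is a sum of at most two irreducible modules
    (LieAlgebra.HasCentralRadical F (GradedLie.even 𝓛) ∧
      LieModule.IsFaithful F (GradedLie.even 𝓛) (GradedLie.odd 𝓛) ∧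
      ComplementedLattice (LieSubmodule F (GradedLie.even 𝓛) (GradedLie.odd 𝓛)) ∧
      (LieModule.IsIrreducible F (GradedLie.even 𝓛) (GradedLie.odd 𝓛) ∨
        ∃ V W : LieSubmodule F (GradedLie.even 𝓛) L,
          LieModule.IsIrreducible F (GradedLie.even 𝓛) V ∧
          LieModule.IsIrreducible F (GradedLie.even 𝓛) W ∧
          V ⊓ W = ⊥ ∧ V ⊔ W = GradedLie.odd 𝓛)) ∧
    -- (2) the center of `𝓛₀` is nonzero iff `𝓛₁` is not irreducible, and what holds then
    ((LieAlgebra.center F (GradedLie.even 𝓛) ≠ ⊥ ↔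
        ¬ LieModule.IsIrreducible F (GradedLie.even 𝓛) (GradedLie.odd 𝓛)) ∧
      (LieAlgebra.center F (GradedLie.even 𝓛) ≠ ⊥ →
        ∃ V W : LieSubmodule F (GradedLie.even 𝓛) L,
          LieModule.IsIrreducible F (GradedLie.even 𝓛) V ∧
          LieModule.IsIrreducible F (GradedLie.even 𝓛) W ∧
          V ⊓ W = ⊥ ∧ V ⊔ W = GradedLie.odd 𝓛 ∧
          (∃ 𝒢 : ℤ → Submodule F L, Nonempty (GradedLieAlgebra 𝒢) ∧
            𝒢 (-1) = W.toSubmodule ∧ 𝒢 0 = 𝓛 0 ∧ 𝒢 1 = V.toSubmodule ∧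
            ∀ n : ℤ, n ≠ -1 → n ≠ 0 → n ≠ 1 → 𝒢 n = ⊥) ∧
          ∃ z : GradedLie.even 𝓛,
            (LieAlgebra.center F (GradedLie.even 𝓛)).toSubmodule = Submodule.span F {z} ∧
            (∀ v ∈ V, ⁅(z : L), v⁆ = v) ∧ (∀ w ∈ W, ⁅(z : L), w⁆ = -w))) ∧
    -- (3) the symmetric invariant bilinear forms on `𝓛₁` form a space of dimension one
    Module.finrank F
      (symmInvariantForms F (GradedLie.even 𝓛) (GradedLie.odd 𝓛)) = 1 := by
  open GradedLie LieAlgebra in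
  refine ⟨⟨?_, isFaithful_odd hodd, ?_, ?_⟩, ⟨⟨fun hc hirr ↦
    hc (center_eq_bot_of_isIrreducible hodd hirr), fun hirr hc ↦ ?_⟩, fun hc ↦ ?_⟩,
    finrank_symmInvariantForms hodd⟩
  -- A Lie algebra with a faithful irreducible module is reductive; V serves when 𝓛₁ is reducible.
  · have := isFaithful_odd hodd
    by_cases hirr : LieModule.IsIrreducible F (even 𝓛) (odd 𝓛)
    · exact (hasCentralRadical_and_of_isIrreducible_of_isFaithful F (even 𝓛) (odd 𝓛)).1
    · obtain ⟨z, -, V, W, -, hV, -, -, hsup, -, hzW⟩ := exists_splitting hodd hirr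
      have := isFaithful_of_splitting hodd hsup hzW
      have := (isIrreducible_iff_isAtom V).mpr hV
      exact (hasCentralRadical_and_of_isIrreducible_of_isFaithful F (even 𝓛) V).1
  · by_cases hirr : LieModule.IsIrreducible F (even 𝓛) (odd 𝓛)
    · infer_instance
    · obtain ⟨z, -, V, W, -, hV, hW, -, hsup, -⟩ := exists_splitting hodd hirr
      exact complementedLattice_of_sup_atoms hV hW hsup
  · refine or_iff_not_imp_left.mpr fun hirr ↦ ?_
    obtain ⟨z, -, V, W, -, hV, hW, hinf, hsup, -⟩ := exists_splitting hodd hirr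
    exact ⟨V, W, (isIrreducible_iff_isAtom V).mpr hV, (isIrreducible_iff_isAtom W).mpr hW, hinf,
      hsup⟩
  · obtain ⟨z, hz, V, W, hzc, hV, -, -, hsup, hzV, -⟩ := exists_splitting hodd hirr
    obtain ⟨v, hv, hv₀⟩ := exists_mem_ne_zero hV.1
    refine hv₀ ?_
    have := (LieSubmodule.eq_bot_iff _).mp hc ⟨z, hz⟩ (mem_center_iff.mpr hzc)
    rw [← hzV v hv, show z = 0 from congr_arg Subtype.val this, zero_lie]
  · obtain ⟨z, hz, V, W, hzc, hV, hW, hinf, hsup, hzV, hzW⟩ := exists_splitting hodd fun hirr ↦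
      hc (center_eq_bot_of_isIrreducible hodd hirr)
    exact ⟨V, W, (isIrreducible_iff_isAtom V).mpr hV, (isIrreducible_iff_isAtom W).mpr hW, hinf,
      hsup, exists_int_grading hzc hinf hsup hzV hzW, ⟨z, hz⟩,
      center_eq_span hz hzc (hsup ▸ le_sup_left) hV.1 hzV, hzV, hzW⟩
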